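/- **Model.** For each $n$, let the parameters be $\kappa\ge 1$ communities, a community assignment $c:\{1,\dots,n\}\to\{1,\dots,\kappa\}$, symmetric affinity values $p_{ab}\in(0,1]$ and sampling probabilities $s_1,s_2\in(0,1)$ (all of which may depend on $n$). The underlying graph $G$ on $\{1,\dots,n\}$ contains each pair $\{i,j\}$, $i\ne j$, independently with probability $p_{c(i)c(j)}$ (stochastic block model). Given $G$, the published network $G_1=(V,E_1)$ and the auxiliary network $G_2=(V,E_2)$ are conditionally independent: $G_1$ keeps each edge of $G$ independently with probability $s_1$; $G_2$ is obtained by keeping each edge of $G$ independently with probability $s_2$ and then relabelling every node $i$ as $\pi_0(i)$, where the bijection $\pi_0$ is the correct mapping. The adversary knows $G_1,G_2$, the parameters and the assignment $c$ of $G_1$ only. A MAP estimate $\hat\pi$ is any maximizer of $\Pr(\pi_0=\pi\mid G_1,G_2)$ over all bijections $\pi$, where a priori all bijections are equally likely. Put $$w_{ij}=\log\frac{1-p_{c(i)c(j)}(s_1+s_2-s_1s_2)}{p_{c(i)c(j)}(1-s_1)(1-s_2)},\qquad \Delta_\pi=\sum_{i<j}w_{ij}\,\mathbb 1\{(i,j)\notin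 E_1,\ (\pi(i),\pi(j))\in E_2\},$$ $\alpha=\min_{a,b}p_{ab}$ and $\beta=\max_{a,b}p_{ab}$. **Theorem.** (a) For all $n$, all parameters and all graphs $G_1,G_2$, the MAP estimates are exactly the minimizers of $\Delta_\pi$ over all bijections $\pi$. (b) There is an absolute constant $C>0$ such that the following holds. Assume that, as $n\to\infty$, $\alpha,\beta\to 0$, that $s_1$ and $s_2$ do not tend to $1$, that $\frac{\log\alpha}{\log\beta}\le\gamma$ for all large $n$, where $\gamma=\gamma(n)$, and that $$D:=\frac{\alpha(1-\beta)^2s_1^2s_2^2\log(1/\alpha)}{s_1+s_2}=\Omega\!\left(\frac{\gamma\log^2 n}{n}\right)+\omega\!\left(\frac1n\right),$$ where moreover the constant hidden in $\Omega$ is not too small, in the sense that $D\ge C\,\frac{\log^2n}{n}$ for all large $n$ (this is automatic if $\gamma\to\infty$). Then, for every choice of the correct mappings $\pi_0=\pi_0(n)$, with probability tending to $1$ as $n\to\infty$ the MAP estimate is unique and $\hat\pi=\pi_0$. -/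

import Mathlib

open Filter Topology Asymptotics

namespace Deanon

/-- The unordered pairs of distinct nodes, each written once as `(i, j)` with `i < j`. -/
def pairs (n : ℕ) : Finset (Fin n × Fin n) :=
  Finset.univ.filter fun e => e.1 < e.2

open Classical in
/-- The probability that a random graph on `n` nodes, in which every pair `i < j` is an edge
independently of the others with probability `q i j`, is equal to `G`. -/
noncomputable def edgeMass {n : ℕ} (q : Fin n → Fin n → ℝ) (G : SimpleGraph (Fin n)) : ENNReal :=
  ∏ e ∈ pairs n, if G.Adj e.1 e.2 then ENNReal.ofReal (q e.1 e.2)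
    else ENNReal.ofReal (1 - q e.1 e.2)

theorem sum_edgeMass {n : ℕ} (q : Fin n → Fin n → ℝ) (hq : ∀ i j, q i j ∈ Set.Icc (0 : ℝ) 1) :
    ∑ G : SimpleGraph (Fin n), edgeMass q G = 1 := by
  classical
  have h1 : ∏ e ∈ pairs n, (ENNReal.ofReal (q e.1 e.2) + ENNReal.ofReal (1 - q e.1 e.2)) = 1 := by
    refine Finset.prod_eq_one fun e _ => ?_
    rw [← ENNReal.ofReal_add (hq _ _).1 (by linarith [(hq e.1 e.2).2])]
    simp
  rw [← h1, Finset.prod_add]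
  refine Finset.sum_bij' (fun G _ => (pairs n).filter fun e => G.Adj e.1 e.2)
    (fun t _ => SimpleGraph.fromRel fun i j => (i, j) ∈ t) ?_ ?_ ?_ ?_ ?_
  · intro G _
    simp
  · intro t _
    simp
  · intro G _
    ext i j
    simp only [SimpleGraph.fromRel_adj, Finset.mem_filter, pairs, Finset.mem_univ, true_and]
    constructor
    · rintro ⟨_, h | h⟩
      · exact h.2
      · exact h.2.symm
    · intro h
      refine ⟨h.ne, ?_⟩
      rcases lt_or_gt_of_ne h.ne with h' | h'
      · exact Or.inl ⟨h', h⟩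
      · exact Or.inr ⟨h', h.symm⟩
  · intro t ht
    rw [Finset.mem_powerset] at ht
    ext ⟨i, j⟩
    simp only [SimpleGraph.fromRel_adj, Finset.mem_filter]
    constructor
    · rintro ⟨hp, _, h | h⟩
      · exact h
      · have h2 := ht h
        simp only [pairs, Finset.mem_filter, Finset.mem_univ, true_and] at hp h2
        exact absurd hp (lt_asymm h2)
    · intro h
      have h2 := ht h
      refine ⟨h2, ?_, Or.inl h⟩
      simp only [pairs, Finset.mem_filter, Finset.mem_univ, true_and] at h2
      exact h2.ne
  · intro G _
    simp only [edgeMass]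
    rw [Finset.prod_ite, Finset.filter_not]

/-- The law of a random graph on `n` nodes in which every pair `i < j` is an edge, independently
of the others, with probability `q i j`. -/
noncomputable def edgeLaw {n : ℕ} (q : Fin n → Fin n → ℝ)
    (hq : ∀ i j, q i j ∈ Set.Icc (0 : ℝ) 1) : PMF (SimpleGraph (Fin n)) :=
  PMF.ofFintype (edgeMass q) (sum_edgeMass q hq)

/-- The parameters of the model on `n` nodes: the number `κ` of communities, the community
assignment `c` of the underlying (and of the published) network, the affinity values `p`, and the
sampling probabilities `s₁`, `s₂`. -/
structure Params (n : ℕ) where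
  κ : ℕ
  κ_pos : 0 < κ
  c : Fin n → Fin κ
  p : Fin κ → Fin κ → ℝ
  p_symm : ∀ a b, p a b = p b a
  p_pos : ∀ a b, 0 < p a b
  p_le_one : ∀ a b, p a b ≤ 1
  s₁ : ℝ
  s₁_pos : 0 < s₁
  s₁_lt_one : s₁ < 1
  s₂ : ℝ
  s₂_pos : 0 < s₂
  s₂_lt_one : s₂ < 1

/-- The edge sampling of a graph `G`: every edge of `G` is kept independently with probability
`s`, and a pair that is not an edge of `G` stays a non-edge. -/
noncomputable def sampleLaw {n : ℕ} (s : ℝ) (hs : s ∈ Set.Icc (0 : ℝ) 1)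
    (G : SimpleGraph (Fin n)) : PMF (SimpleGraph (Fin n)) :=
  open Classical in
  edgeLaw (fun i j => if G.Adj i j then s else 0) fun i j => by
    split_ifs
    · exact hs
    · simp

namespace Params

variable {n : ℕ} (θ : Params n)

/-- The smallest affinity value. -/
noncomputable def α : ℝ := ⨅ ab : Fin θ.κ × Fin θ.κ, θ.p ab.1 ab.2

/-- The largest affinity value. -/
noncomputable def β : ℝ := ⨆ ab : Fin θ.κ × Fin θ.κ, θ.p ab.1 ab.2

/-- The law of the underlying network: the stochastic block model. -/
noncomputable def underlyingLaw : PMF (SimpleGraph (Fin n)) :=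
  edgeLaw (fun i j => θ.p (θ.c i) (θ.c j)) fun _ _ => ⟨(θ.p_pos _ _).le, θ.p_le_one _ _⟩

/-- The joint law of the published network `G₁` and the auxiliary network `G₂` when the correct
mapping is `π₀`: both are obtained by independent edge sampling from the same underlying network
`G`; `G₁` keeps the node labels of `G`, while node `i` of `G` gets the label `π₀ i` in `G₂`. -/
noncomputable def observedLaw (π₀ : Equiv.Perm (Fin n)) :
    PMF (SimpleGraph (Fin n) × SimpleGraph (Fin n)) :=
  θ.underlyingLaw.bind fun G =>
    (sampleLaw θ.s₁ ⟨θ.s₁_pos.le, θ.s₁_lt_one.le⟩ G).bind fun G₁ =>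
      (sampleLaw θ.s₂ ⟨θ.s₂_pos.le, θ.s₂_lt_one.le⟩ G).map fun H =>
        (G₁, H.map π₀.toEmbedding)

/-- The joint law of `(π₀, (G₁, G₂))` when nothing is known about the correct mapping in advance,
that is, when all bijections are equally likely to be `π₀`. -/
noncomputable def jointLaw :
    PMF (Equiv.Perm (Fin n) × (SimpleGraph (Fin n) × SimpleGraph (Fin n))) :=
  (PMF.uniformOfFintype (Equiv.Perm (Fin n))).bind fun π₀ =>
    (θ.observedLaw π₀).map fun x => (π₀, x)

/-- The posterior probability `Pr(π₀ = π ∣ G₁ = g₁, G₂ = g₂)` (given `c` and the parameters). -/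
noncomputable def posterior (g₁ g₂ : SimpleGraph (Fin n)) (π : Equiv.Perm (Fin n)) : ENNReal :=
  θ.jointLaw (π, (g₁, g₂)) / ∑ π' : Equiv.Perm (Fin n), θ.jointLaw (π', (g₁, g₂))

/-- `π` is a maximum a posteriori estimate of the correct mapping, among all bijections. -/
def IsMAPEstimate (g₁ g₂ : SimpleGraph (Fin n)) (π : Equiv.Perm (Fin n)) : Prop :=
  ∀ π' : Equiv.Perm (Fin n), θ.posterior g₁ g₂ π' ≤ θ.posterior g₁ g₂ π

/-- The weight of the node pair `(i, j)`. -/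
noncomputable def w (i j : Fin n) : ℝ :=
  Real.log ((1 - θ.p (θ.c i) (θ.c j) * (θ.s₁ + θ.s₂ - θ.s₁ * θ.s₂)) /
    (θ.p (θ.c i) (θ.c j) * (1 - θ.s₁) * (1 - θ.s₂)))

open Classical in
/-- The cost of a mapping: the single-sided weighted edge disagreement. -/
noncomputable def cost (g₁ g₂ : SimpleGraph (Fin n)) (π : Equiv.Perm (Fin n)) : ℝ :=
  ∑ e ∈ pairs n, θ.w e.1 e.2 * if ¬ g₁.Adj e.1 e.2 ∧ g₂.Adj (π e.1) (π e.2) then 1 else 0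

/-- `π` minimizes the cost among all bijections. -/
def IsCostMinimizer (g₁ g₂ : SimpleGraph (Fin n)) (π : Equiv.Perm (Fin n)) : Prop :=
  ∀ π' : Equiv.Perm (Fin n), θ.cost g₁ g₂ π ≤ θ.cost g₁ g₂ π'

/-- The quantity `α (1 - β)² s₁² s₂² log (1 / α) / (s₁ + s₂)`. -/
noncomputable def density : ℝ :=
  θ.α * (1 - θ.β) ^ 2 * θ.s₁ ^ 2 * θ.s₂ ^ 2 * Real.log (1 / θ.α) / (θ.s₁ + θ.s₂)

end Params

end Deanon

/-! (a) The likelihood of a mapping is a product over node pairs of a positive 2×2 table in the two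
edge indicators. Such a table is a row factor times a column factor times its odds ratio in one
cell. The column factor `s₂ / (1 - s₂)` is the same for all pairs, so relabelling `G₂` does not
change its product; only `exp (-cost)` depends on the mapping.

(b) By a union bound it suffices to sum, over `π ≠ π₀`, the probability that `π` is at least as
likely as `π₀`. Each is at most the Bhattacharyya sum of `√(L(π₀) L(π))` over all observations.
Summing out `G₁` pair by pair leaves a contraction of 2×2 overlap matrices along the permutation of
node pairs induced by `π₀⁻¹ * π`. By `sum_prod_perm_le` a fixed pair costs a trace, which is 1, and
a moved pair a Hilbert–Schmidt norm, at most `exp (-p s₁ s₂ / 2)`. If `m` nodes move, at least `m (n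
- 2) / 2` pairs move (`card_support_mul_le`), so the term is at most `x ^ m` with `x = exp (-α s₁ s₂
(n - 2) / 4)`. All permutations together give at most `(1 + n x) ^ n - 1`, which vanishes once `x ≤
n⁻³`; the density hypothesis ensures this. -/

namespace Deanon

/-! ### Contraction of nonnegative matrices along a permutation. -/

section TraceInequality

open Matrix

/-- The Hilbert–Schmidt norm of a real square matrix. -/
noncomputable def hsNorm {κ : Type*} [Fintype κ] (A : Matrix κ κ ℝ) : ℝ :=
  √(∑ x, ∑ y, A x y ^ 2)

theorem hsNorm_nonneg {κ : Type*} [Fintype κ] (A : Matrix κ κ ℝ) : 0 ≤ hsNorm A :=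
  Real.sqrt_nonneg _

theorem hsNorm_sq {κ : Type*} [Fintype κ] (A : Matrix κ κ ℝ) :
    hsNorm A ^ 2 = ∑ x, ∑ y, A x y ^ 2 :=
  Real.sq_sqrt (Finset.sum_nonneg fun _ _ => Finset.sum_nonneg fun _ _ => sq_nonneg _)

theorem trace_mul_le_hsNorm {κ : Type*} [Fintype κ] (A B : Matrix κ κ ℝ) :
    trace (A * B) ≤ hsNorm A * hsNorm B := by
  refine abs_le_of_sq_le_sq' ?_ (mul_nonneg (hsNorm_nonneg A) (hsNorm_nonneg B)) |>.2
  rw [mul_pow, hsNorm_sq, hsNorm_sq, Finset.sum_comm (f := fun x y => B x y ^ 2)]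
  simp only [trace, diag_apply, mul_apply, ← Fintype.sum_prod_type']
  exact Finset.sum_mul_sq_le_sq_mul_sq _ _ _

theorem hsNorm_mul_le {κ : Type*} [Fintype κ] (A B : Matrix κ κ ℝ) :
    hsNorm (A * B) ≤ hsNorm A * hsNorm B := by
  refine abs_le_of_sq_le_sq' ?_ (mul_nonneg (hsNorm_nonneg A) (hsNorm_nonneg B)) |>.2
  rw [mul_pow, hsNorm_sq, hsNorm_sq, hsNorm_sq, Finset.sum_comm (f := fun x y => B x y ^ 2),
    Finset.sum_mul_sum]
  simp only [mul_apply]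
  exact Finset.sum_le_sum fun x _ => Finset.sum_le_sum fun y _ =>
    Finset.sum_mul_sq_le_sq_mul_sq _ _ _

open Classical in
/-- The factor of the index `e` in the bound for the contraction of matrices along a
permutation. -/
noncomputable def traceFactor {ι κ : Type*} [Fintype κ] (τ : Equiv.Perm ι)
    (f : ι → Matrix κ κ ℝ) (e : ι) : ℝ :=
  if τ e = e then trace (f e) else hsNorm (f e)

theorem traceFactor_nonneg {ι κ : Type*} [Fintype κ] (τ : Equiv.Perm ι)
    (f : ι → Matrix κ κ ℝ) (hf : ∀ e x y, 0 ≤ f e x y) (e : ι) : 0 ≤ traceFactor τ f e := by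
  unfold traceFactor
  split_ifs
  · exact Finset.sum_nonneg fun x _ => hf e x x
  · exact hsNorm_nonneg _

/-- The contraction of nonnegative matrices along a permutation is at most the product of the
traces over its fixed points and of the Hilbert–Schmidt norms over the other points. -/
theorem sum_prod_perm_le {κ : Type*} [Fintype κ] {ι : Type} [Fintype ι] [DecidableEq ι] :
    ∀ (τ : Equiv.Perm ι) (f : ι → Matrix κ κ ℝ), (∀ e x y, 0 ≤ f e x y) →
      ∑ h : ι → κ, ∏ e, f e (h e) (h (τ e)) ≤ ∏ e, traceFactor τ f e := by
  classical
  suffices H : ∀ (ι : Type) [Fintype ι] (τ : Equiv.Perm ι) (f : ι → Matrix κ κ ℝ),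
      (∀ e x y, 0 ≤ f e x y) →
        ∑ h : ι → κ, ∏ e, f e (h e) (h (τ e)) ≤ ∏ e, traceFactor τ f e by
    intro τ f hf
    convert H ι τ f hf
  refine Fintype.induction_empty_option (P := fun ι _ => ∀ (τ : Equiv.Perm ι)
    (f : ι → Matrix κ κ ℝ), (∀ e x y, 0 ≤ f e x y) →
      ∑ h : ι → κ, ∏ e, f e (h e) (h (τ e)) ≤ ∏ e, traceFactor τ f e) ?_ ?_ ?_
  · intro α β _ u hα τ f hf
    let _ := Fintype.ofEquiv _ u.symm
    have h1 := hα ((u.trans τ).trans u.symm) (fun e => f (u e)) fun e => hf (u e)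
    have h2 : ∏ e, traceFactor ((u.trans τ).trans u.symm) (fun e => f (u e)) e
        = ∏ e, traceFactor τ f e := by
      refine Fintype.prod_equiv u _ _ fun e => ?_
      simp [traceFactor, Equiv.symm_apply_eq]
    rw [h2] at h1
    refine le_trans (le_of_eq ?_) h1
    refine Fintype.sum_equiv (Equiv.arrowCongr u.symm (Equiv.refl κ)) _ _ fun h => ?_
    refine Fintype.prod_equiv u.symm _ _ fun e => ?_
    simp
  · intro τ f _
    simp
  · intro ι _ ih σ f hf
    -- `i` is the image of `none`, and `τ` is the permutation left after cutting `none` out of its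
    -- cycle.
    obtain ⟨⟨i, τ⟩, rfl⟩ := Equiv.Perm.decomposeOption.symm.surjective σ
    have hsum : ∀ (_ : Fintype (Option ι → κ)) (F : (Option ι → κ) → ℝ), ∑ h, F h
        = ∑ h : ι → κ, ∑ x, F (Equiv.piOptionEquivProd.symm (x, h)) := by
      intro _ F
      rw [Finset.sum_comm, ← Fintype.sum_prod_type']
      exact Fintype.sum_equiv Equiv.piOptionEquivProd _ _ fun h =>
        congrArg F (Equiv.symm_apply_apply _ h).symm
    refine (hsum _ _).trans_le ?_
    simp only [Fintype.prod_option]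
    cases i with
    | none =>
      have h1 := ih τ (fun e => f (some e)) fun e => hf _
      have h2 : ∀ e, traceFactor (Equiv.Perm.decomposeOption.symm (none, τ)) f (some e)
          = traceFactor τ (fun e => f (some e)) e := by
        intro e
        simp [traceFactor]
      have h3 : traceFactor (Equiv.Perm.decomposeOption.symm (none, τ)) f none
          = trace (f none) := by
        simp [traceFactor]
      simp only [h2, h3]
      refine le_trans (le_of_eq ?_) (mul_le_mul_of_nonneg_left h1
        (Finset.sum_nonneg fun x _ => hf none x x))
      rw [Finset.mul_sum]
      refine Finset.sum_congr rfl fun h _ => ?_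
      rw [trace, Finset.sum_mul]
      refine Finset.sum_congr rfl fun x _ => ?_
      simp [Equiv.piOptionEquivProd]
    | some a =>
      -- The arrow `b → a` of `τ` is replaced by `b → none → a`. Summing over the value at `none`
      -- therefore multiplies the two matrices, and the induction hypothesis applies with the
      -- product placed at `b`.
      set b := τ.symm a with hb
      have hτb : τ b = a := by simp [hb]
      have hσb : Equiv.Perm.decomposeOption.symm (some a, τ) (some b) = none := by
        simp [hτb]
      have hσn : Equiv.Perm.decomposeOption.symm (some a, τ) none = some a := by simp
      have hσe : ∀ e, e ≠ b →
          Equiv.Perm.decomposeOption.symm (some a, τ) (some e) = some (τ e) := by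
        intro e he
        have : τ e ≠ a := fun h => he (τ.injective (h.trans hτb.symm))
        simp only [Equiv.Perm.decomposeOption_symm_apply, Equiv.Perm.coe_mul, Function.comp_apply,
          Equiv.optionCongr_apply, Option.map_some]
        exact Equiv.swap_apply_of_ne_of_ne (by simp) (by simpa using this)
      generalize Equiv.Perm.decomposeOption.symm (some a, τ) = σ at hσb hσn hσe ⊢
      set f' : ι → Matrix κ κ ℝ := Function.update (fun e => f (some e)) b
        (f (some b) * f none) with hf'
      have hf'b : f' b = f (some b) * f none := by simp [hf']
      have hf'e : ∀ e, e ≠ b → f' e = f (some e) := fun e he => by simp [hf', he]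
      have hnn : ∀ e x y, 0 ≤ f' e x y := by
        intro e x y
        rcases eq_or_ne e b with rfl | he
        · rw [hf'b]
          exact Finset.sum_nonneg fun z _ => mul_nonneg (hf _ _ _) (hf _ _ _)
        · rw [hf'e e he]
          exact hf _ _ _
      have h1 := ih τ f' hnn
      have hsplit : ∀ F : ι → ℝ, ∏ e, F e = F b * ∏ e ∈ Finset.univ.erase b, F e := fun F =>
        (Finset.mul_prod_erase _ _ (Finset.mem_univ b)).symm
      refine le_trans (le_of_eq ?_) (h1.trans ?_)
      · refine Finset.sum_congr rfl fun h _ => ?_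
        rw [hsplit, hf'b, mul_apply, Finset.sum_mul, hτb]
        refine Finset.sum_congr rfl fun x _ => ?_
        rw [hsplit, hσn, hσb]
        have : ∏ e ∈ Finset.univ.erase b, f (some e)
              ((Equiv.piOptionEquivProd (β := fun _ => κ)).symm (x, h) (some e))
              ((Equiv.piOptionEquivProd (β := fun _ => κ)).symm (x, h) (σ (some e)))
            = ∏ e ∈ Finset.univ.erase b, f' e (h e) (h (τ e)) := by
          refine Finset.prod_congr rfl fun e he => ?_
          rw [hσe e (Finset.ne_of_mem_erase he), hf'e e (Finset.ne_of_mem_erase he)]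
          rfl
        rw [this]
        simp only [Equiv.piOptionEquivProd, Equiv.coe_fn_symm_mk]
        ring
      · rw [hsplit, hsplit, ← mul_assoc]
        have hrest : ∏ e ∈ Finset.univ.erase b, traceFactor τ f' e
            = ∏ e ∈ Finset.univ.erase b, traceFactor σ f (some e) := by
          refine Finset.prod_congr rfl fun e he => ?_
          simp [traceFactor, hσe e (Finset.ne_of_mem_erase he),
            hf'e e (Finset.ne_of_mem_erase he)]
        rw [hrest]
        refine mul_le_mul_of_nonneg_right ?_
          (Finset.prod_nonneg fun e _ => traceFactor_nonneg σ f hf _)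
        have hn : traceFactor σ f none = hsNorm (f none) := by simp [traceFactor, hσn]
        have hsb : traceFactor σ f (some b) = hsNorm (f (some b)) := by simp [traceFactor, hσb]
        rw [hn, hsb, mul_comm, traceFactor, hf'b]
        -- If `τ` fixes `b`, then `none` and `b` form a 2-cycle and the product contributes a trace;
        -- otherwise it contributes a norm.
        split_ifs
        · exact trace_mul_le_hsNorm _ _
        · exact hsNorm_mul_le _ _

end TraceInequality

end Deanon

/-! ### Counting permutations and the pairs of nodes they move. -/

namespace Deanon

/-- The sum over all permutations of `x` to the power of the number of moved points. -/
theorem sum_perm_pow_support_le {ι : Type*} [Fintype ι] [DecidableEq ι] {x : ℝ} (hx : 0 ≤ x) :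
    ∑ σ : Equiv.Perm ι, x ^ σ.support.card ≤ (1 + Fintype.card ι * x) ^ Fintype.card ι := by
  have h1 : ∀ σ : Equiv.Perm ι,
      x ^ σ.support.card = ∏ i, if σ i = i then (1 : ℝ) else x := by
    intro σ
    rw [Finset.prod_ite, Finset.prod_const_one, one_mul, Finset.prod_const]
    rfl
  have h2 : ∑ f : ι → ι, ∏ i, (if f i = i then (1 : ℝ) else x)
      = ∏ i : ι, ∑ j : ι, (if j = i then (1 : ℝ) else x) := by
    rw [Finset.prod_univ_sum, Fintype.piFinset_univ]
  calc ∑ σ : Equiv.Perm ι, x ^ σ.support.card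
      = ∑ f ∈ Finset.univ.map ⟨fun σ : Equiv.Perm ι => (σ : ι → ι), DFunLike.coe_injective⟩,
          ∏ i, (if f i = i then (1 : ℝ) else x) := by
        rw [Finset.sum_map]
        exact Finset.sum_congr rfl fun σ _ => h1 σ
    -- Dropping injectivity makes the sum factor over the points.
    _ ≤ ∑ f : ι → ι, ∏ i, (if f i = i then (1 : ℝ) else x) := by
        refine Finset.sum_le_sum_of_subset_of_nonneg (Finset.subset_univ _) fun f _ _ => ?_
        exact Finset.prod_nonneg fun i _ => by split_ifs <;> linarith
    _ ≤ ∏ _i : ι, (1 + Fintype.card ι * x) := by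
        rw [h2]
        refine Finset.prod_le_prod (fun i _ => Finset.sum_nonneg fun j _ => by
          split_ifs <;> linarith) fun i _ => ?_
        calc ∑ j : ι, (if j = i then (1 : ℝ) else x)
            ≤ ∑ j : ι, ((if j = i then (1 : ℝ) else 0) + x) :=
              Finset.sum_le_sum fun j _ => by split_ifs <;> linarith
          _ = 1 + Fintype.card ι * x := by
              rw [Finset.sum_add_distrib]
              simp
    _ = _ := by simp

/-- The unordered pairs of distinct nodes. -/
abbrev NodePair (n : ℕ) : Type := {e : Sym2 (Fin n) // ¬ e.IsDiag}

theorem isDiag_map_perm {n : ℕ} (π : Equiv.Perm (Fin n)) (e : Sym2 (Fin n)) :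
    (e.map π).IsDiag ↔ e.IsDiag := by
  induction e with
  | _ i j => simp

/-- The action of a permutation of the nodes on the pairs of nodes. -/
def edgePerm {n : ℕ} (π : Equiv.Perm (Fin n)) : Equiv.Perm (NodePair n) where
  toFun e := ⟨e.1.map π, fun h => e.2 ((isDiag_map_perm π _).1 h)⟩
  invFun e := ⟨e.1.map π.symm, fun h => e.2 ((isDiag_map_perm π.symm _).1 h)⟩
  left_inv e := by
    ext1
    simp [Sym2.map_map]
  right_inv e := by
    ext1
    simp [Sym2.map_map]

theorem edgePerm_symm_edgePerm {n : ℕ} (π₀ π : Equiv.Perm (Fin n)) (e : NodePair n) :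
    (edgePerm π₀).symm (edgePerm π e) = edgePerm (π₀⁻¹ * π) e := by
  rw [Equiv.symm_apply_eq]
  ext1
  simp [edgePerm, Sym2.map_map, Function.comp_def]

/-- A permutation that moves `m` nodes moves at least `m (n - 2) / 2` pairs of nodes. -/
theorem card_support_mul_le {n : ℕ} (σ : Equiv.Perm (Fin n)) :
    σ.support.card * (n - 2) ≤ 2 * (edgePerm σ).support.card := by
  -- If `i` moves and `j ≠ i, σ i`, then `{i, j}` is moved: fixing it would force `σ i ∈ {i, j}`.
  -- Each unordered pair arises from at most two such `(i, j)`.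
  let S : Finset (Fin n × Fin n) :=
    σ.support.biUnion fun i => (({i, σ i} : Finset (Fin n))ᶜ).image fun j => (i, j)
  have hS : ∀ x, x ∈ S ↔ σ x.1 ≠ x.1 ∧ x.2 ≠ x.1 ∧ x.2 ≠ σ x.1 := by
    rintro ⟨i, j⟩
    simp [S]
  have hcard : S.card = σ.support.card * (n - 2) := by
    rw [Finset.card_biUnion]
    · refine Finset.sum_const_nat fun i hi => ?_
      rw [Finset.card_image_of_injective _ (fun a b h => by simpa using h), Finset.card_compl,
        Fintype.card_fin, Finset.card_pair (Equiv.Perm.mem_support.1 hi).symm]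
    · intro i _ i' _ h
      rw [Function.onFun, Finset.disjoint_left]
      intro x hx hx'
      simp only [Finset.mem_image] at hx hx'
      obtain ⟨_, _, rfl⟩ := hx
      obtain ⟨_, _, h'⟩ := hx'
      exact h (Prod.ext_iff.1 h').1.symm
  let T : Finset (Sym2 (Fin n)) := (edgePerm σ).support.map (Function.Embedding.subtype _)
  have hT : T.card = (edgePerm σ).support.card := Finset.card_map _
  rw [← hcard, ← hT]
  refine Finset.card_le_mul_card_image_of_maps_to (f := fun x => s(x.1, x.2)) ?_ 2 ?_
  · rintro ⟨i, j⟩ hx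
    obtain ⟨h1, h2, h3⟩ := (hS _).1 hx
    simp only [T, Finset.mem_map, Function.Embedding.subtype_apply, Subtype.exists,
      exists_and_right, exists_eq_right, Equiv.Perm.mem_support]
    refine ⟨by simpa using fun h => h2 h.symm, fun h => ?_⟩
    have h' := congrArg Subtype.val h
    simp only [edgePerm, Equiv.coe_fn_mk, Sym2.map_mk, Sym2.eq_iff] at h'
    rcases h' with h' | h'
    · exact h1 h'.1
    · exact h3 h'.1.symm
  · intro e _
    induction e with
    | _ a b =>
      refine (Finset.card_le_card (t := {(a, b), (b, a)}) ?_).trans Finset.card_le_two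
      rintro ⟨i, j⟩ hx
      simpa using (Finset.mem_filter.1 hx).2

end Deanon

/-! ### Factorization of the likelihood over pairs. -/

namespace Deanon

open Classical in
/-- The indicator of the edge set of a graph. -/
noncomputable def hasEdge {n : ℕ} (G : SimpleGraph (Fin n)) (e : Sym2 (Fin n)) : Bool :=
  decide (e ∈ G.edgeSet)

theorem hasEdge_mk {n : ℕ} (G : SimpleGraph (Fin n)) (i j : Fin n) :
    hasEdge G s(i, j) = true ↔ G.Adj i j := by
  simp [hasEdge]

/-- Graphs correspond to the functions on the pairs of distinct nodes with two values. -/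
noncomputable def graphEquiv (n : ℕ) : SimpleGraph (Fin n) ≃ (NodePair n → Bool) where
  toFun G e := hasEdge G e
  invFun f := SimpleGraph.fromEdgeSet {e | ∃ h : ¬ e.IsDiag, f ⟨e, h⟩ = true}
  left_inv G := by
    ext i j
    simp only [hasEdge_mk, SimpleGraph.fromEdgeSet_adj, Set.mem_ofPred_eq, Sym2.mk_isDiag_iff]
    exact ⟨fun h => h.1.2, fun h => ⟨⟨h.ne, h⟩, h.ne⟩⟩
  right_inv f := by
    funext ⟨e, he⟩
    induction e with
    | _ i j =>
      rw [Bool.eq_iff_iff, hasEdge_mk]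
      simp only [SimpleGraph.fromEdgeSet_adj, Set.mem_ofPred_eq]
      exact ⟨fun h => h.1.2, fun h => ⟨⟨he, h⟩, by simpa using he⟩⟩

theorem prod_pairs {n : ℕ} {M : Type*} [CommMonoid M] (F : Sym2 (Fin n) → M) :
    ∏ e ∈ pairs n, F s(e.1, e.2) = ∏ e : NodePair n, F e := by
  classical
  rw [← Finset.prod_subtype (Finset.univ.filter fun e : Sym2 (Fin n) => ¬ e.IsDiag)
    (fun e => by simp) F]
  refine Finset.prod_bij (fun e _ => s(e.1, e.2)) ?_ ?_ ?_ fun _ _ => rfl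
  · rintro ⟨i, j⟩ h
    simp only [pairs, Finset.mem_filter, Finset.mem_univ, true_and] at h
    simpa using h.ne
  · rintro ⟨i, j⟩ h ⟨i', j'⟩ h' heq
    simp only [pairs, Finset.mem_filter, Finset.mem_univ, true_and] at h h'
    rcases Sym2.eq_iff.1 heq with ⟨rfl, rfl⟩ | ⟨rfl, rfl⟩
    · rfl
    · exact absurd h (lt_asymm h')
  · intro e he
    induction e with
    | _ i j =>
      have hij : i ≠ j := by simpa using he
      rcases lt_or_gt_of_ne hij with h | h
      · exact ⟨(i, j), by simpa [pairs] using h, rfl⟩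
      · exact ⟨(j, i), by simpa [pairs] using h, Sym2.eq_swap⟩

theorem sum_pairs {n : ℕ} {M : Type*} [AddCommMonoid M] (F : Sym2 (Fin n) → M) :
    ∑ e ∈ pairs n, F s(e.1, e.2) = ∑ e : NodePair n, F e :=
  prod_pairs (M := Multiplicative M) F

theorem sum_prod_hasEdge {n : ℕ} {R : Type*} [CommSemiring R] (F : NodePair n → Bool → R) :
    ∑ G : SimpleGraph (Fin n), ∏ e : NodePair n, F e (hasEdge G e)
      = ∏ e : NodePair n, (F e true + F e false) := by
  classical
  refine (Fintype.sum_equiv (graphEquiv n) _ (fun h => ∏ e : NodePair n, F e (h e))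
    fun G => rfl).trans ?_
  simp_rw [← Fintype.sum_bool]
  rw [Finset.prod_univ_sum, Fintype.piFinset_univ]

/-- The probability that a pair of affinity `p` is (`a = true`) or is not (`a = false`) an edge
of the published network, and likewise for `b` and the auxiliary network. -/
noncomputable def jointMass (p s₁ s₂ : ℝ) (a b : Bool) : ℝ :=
  p * ((if a then s₁ else 1 - s₁) * if b then s₂ else 1 - s₂) +
    (1 - p) * ((if a then 0 else 1) * if b then 0 else 1)

namespace Params

variable {n : ℕ} (θ : Params n)

/-- The affinity of a pair of nodes. -/
noncomputable def edgeProb : Sym2 (Fin n) → ℝ :=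
  Sym2.lift ⟨fun i j => θ.p (θ.c i) (θ.c j), fun _ _ => θ.p_symm _ _⟩

theorem edgeProb_pos (e : Sym2 (Fin n)) : 0 < θ.edgeProb e := by
  induction e with
  | _ i j => exact θ.p_pos _ _

theorem edgeProb_le_one (e : Sym2 (Fin n)) : θ.edgeProb e ≤ 1 := by
  induction e with
  | _ i j => exact θ.p_le_one _ _

/-- The probability of the observed networks when the correct mapping is `π`. -/
noncomputable def likelihood (g₁ g₂ : SimpleGraph (Fin n)) (π : Equiv.Perm (Fin n)) : ℝ :=
  ∏ e : NodePair n, jointMass (θ.edgeProb e) θ.s₁ θ.s₂ (hasEdge g₁ e) (hasEdge g₂ (edgePerm π e))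

end Params

theorem jointMass_pos {p s₁ s₂ : ℝ} (hp : 0 < p) (hp1 : p ≤ 1) (h1 : 0 < s₁) (h1' : s₁ < 1)
    (h2 : 0 < s₂) (h2' : s₂ < 1) (a b : Bool) : 0 < jointMass p s₁ s₂ a b := by
  have h3 : 0 < 1 - s₁ := by linarith
  have h4 : 0 < 1 - s₂ := by linarith
  have h5 : 0 ≤ 1 - p := by linarith
  unfold jointMass
  cases a <;> cases b <;> simp only [if_true, if_false, Bool.false_eq_true] <;> positivity

theorem edgeMass_eq_prod {n : ℕ} (q : Sym2 (Fin n) → ℝ) (G : SimpleGraph (Fin n)) :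
    edgeMass (fun i j => q s(i, j)) G
      = ∏ e : NodePair n, ENNReal.ofReal (if hasEdge G e then q e else 1 - q e) := by
  rw [edgeMass, ← prod_pairs fun e => ENNReal.ofReal (if hasEdge G e then q e else 1 - q e)]
  refine Finset.prod_congr rfl fun e _ => ?_
  by_cases h : G.Adj e.1 e.2
  · rw [if_pos h, if_pos ((hasEdge_mk G _ _).2 h)]
  · rw [if_neg h, if_neg (mt (hasEdge_mk G _ _).1 h)]

theorem sampleLaw_apply {n : ℕ} (s : ℝ) (hs : s ∈ Set.Icc (0 : ℝ) 1)
    (G H : SimpleGraph (Fin n)) :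
    sampleLaw s hs G H = ∏ e : NodePair n, ENNReal.ofReal
      (if hasEdge G e then (if hasEdge H e then s else 1 - s)
        else (if hasEdge H e then 0 else 1)) := by
  classical
  have h := edgeMass_eq_prod (fun e => if hasEdge G e then s else 0) H
  simp only [hasEdge_mk] at h
  have h' : sampleLaw s hs G H = edgeMass (fun i j => if G.Adj i j then s else 0) H := by
    rw [sampleLaw, edgeLaw, PMF.ofFintype_apply]
  rw [h', h]
  refine Finset.prod_congr rfl fun e _ => ?_
  split_ifs <;> simp

theorem bind_map_prodMk_apply {α β γ : Type*} [Fintype α] [Fintype β] (μ : PMF α) (ν : PMF β)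
    {f : β → γ} (hf : Function.Injective f) (a : α) (b : β) :
    (μ.bind fun x => ν.map fun y => (x, f y)) (a, f b) = μ a * ν b := by
  classical
  rw [PMF.bind_apply, tsum_fintype, Finset.sum_eq_single a]
  · rw [PMF.map_apply, tsum_fintype, Finset.sum_eq_single b]
    · simp
    · intro y _ hy
      rw [if_neg]
      exact fun h => hy (hf (Prod.ext_iff.1 h).2).symm
    · simp
  · intro x _ hx
    rw [PMF.map_apply, tsum_fintype, Finset.sum_eq_zero, mul_zero]
    intro y _
    rw [if_neg]
    exact fun h => hx (Prod.ext_iff.1 h).1.symm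
  · simp

namespace Params

variable {n : ℕ} (θ : Params n)

theorem jointMass_edgeProb_pos (e : Sym2 (Fin n)) (a b : Bool) :
    0 < jointMass (θ.edgeProb e) θ.s₁ θ.s₂ a b :=
  jointMass_pos (θ.edgeProb_pos e) (θ.edgeProb_le_one e) θ.s₁_pos θ.s₁_lt_one θ.s₂_pos
    θ.s₂_lt_one a b

theorem likelihood_pos (g₁ g₂ : SimpleGraph (Fin n)) (π : Equiv.Perm (Fin n)) :
    0 < θ.likelihood g₁ g₂ π :=
  Finset.prod_pos fun e _ => θ.jointMass_edgeProb_pos e _ _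

theorem observedLaw_apply (g₁ g₂ : SimpleGraph (Fin n)) (π : Equiv.Perm (Fin n)) :
    θ.observedLaw π (g₁, g₂) = ENNReal.ofReal (θ.likelihood g₁ g₂ π) := by
  -- Undoing the relabelling gives the only sample of the underlying graph that is published as
  -- `g₂`.
  set H := g₂.comap π.toEmbedding with hH
  have hg : H.map π.toEmbedding = g₂ := by
    ext i j
    simp only [SimpleGraph.map_adj, hH, SimpleGraph.comap_adj]
    constructor
    · rintro ⟨_, _, h, rfl, rfl⟩
      exact h
    · intro h
      exact ⟨π.symm i, π.symm j, by simpa using h, by simp, by simp⟩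
  have hHe : ∀ e : NodePair n, hasEdge H e = hasEdge g₂ (edgePerm π e) := by
    rintro ⟨e, he⟩
    induction e with
    | _ i j =>
      rw [Bool.eq_iff_iff]
      exact (hasEdge_mk H i j).trans (hasEdge_mk g₂ (π i) (π j)).symm
  have hinj : Function.Injective fun K : SimpleGraph (Fin n) => K.map π.toEmbedding :=
    SimpleGraph.map_injective _
  have h1 : θ.observedLaw π (g₁, g₂) = ∑ G : SimpleGraph (Fin n),
      (∏ e : NodePair n, ENNReal.ofReal
        (if hasEdge G e then θ.edgeProb e else 1 - θ.edgeProb e)) *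
      ((∏ e : NodePair n, ENNReal.ofReal
        (if hasEdge G e then (if hasEdge g₁ e then θ.s₁ else 1 - θ.s₁)
          else (if hasEdge g₁ e then 0 else 1))) *
        ∏ e : NodePair n, ENNReal.ofReal
        (if hasEdge G e then (if hasEdge H e then θ.s₂ else 1 - θ.s₂)
          else (if hasEdge H e then 0 else 1))) := by
    rw [observedLaw, PMF.bind_apply, tsum_fintype]
    refine Finset.sum_congr rfl fun G _ => ?_
    refine congrArg₂ _ (edgeMass_eq_prod θ.edgeProb G) ?_
    rw [← sampleLaw_apply θ.s₁ ⟨θ.s₁_pos.le, θ.s₁_lt_one.le⟩ G g₁,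
      ← sampleLaw_apply θ.s₂ ⟨θ.s₂_pos.le, θ.s₂_lt_one.le⟩ G H,
      ← bind_map_prodMk_apply _ _ hinj, hg]
  have h3 : ENNReal.ofReal (θ.likelihood g₁ g₂ π) = ∏ e : NodePair n, ENNReal.ofReal
      (jointMass (θ.edgeProb e) θ.s₁ θ.s₂ (hasEdge g₁ e) (hasEdge g₂ (edgePerm π e))) :=
    ENNReal.ofReal_prod_of_nonneg fun e _ => (θ.jointMass_edgeProb_pos e _ _).le
  rw [h1, h3]
  simp only [← Finset.prod_mul_distrib]
  rw [sum_prod_hasEdge fun (e : NodePair n) b => ENNReal.ofReal (if b then θ.edgeProb e else 1 - θ.edgeProb e) *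
    (ENNReal.ofReal (if b then (if hasEdge g₁ e then θ.s₁ else 1 - θ.s₁)
        else (if hasEdge g₁ e then 0 else 1)) *
      ENNReal.ofReal (if b then (if hasEdge H e then θ.s₂ else 1 - θ.s₂)
        else (if hasEdge H e then 0 else 1)))]
  refine Finset.prod_congr rfl fun e _ => ?_
  have hp := θ.edgeProb_pos e
  have hp1 : 0 ≤ 1 - θ.edgeProb e := by linarith [θ.edgeProb_le_one e]
  have hs1 := θ.s₁_pos
  have hs2 := θ.s₂_pos
  have hs1' : 0 ≤ 1 - θ.s₁ := by linarith [θ.s₁_lt_one]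
  have hs2' : 0 ≤ 1 - θ.s₂ := by linarith [θ.s₂_lt_one]
  simp only [if_true, if_false, Bool.false_eq_true, hHe]
  have ha : 0 ≤ if hasEdge g₁ e then θ.s₁ else 1 - θ.s₁ := by split_ifs <;> linarith
  have ha' : (0 : ℝ) ≤ if hasEdge g₁ e then 0 else 1 := by split_ifs <;> norm_num
  have hb : 0 ≤ if hasEdge g₂ (edgePerm π e) then θ.s₂ else 1 - θ.s₂ := by
    split_ifs <;> linarith
  have hb' : (0 : ℝ) ≤ if hasEdge g₂ (edgePerm π e) then 0 else 1 := by split_ifs <;> norm_num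
  rw [← ENNReal.ofReal_mul ha, ← ENNReal.ofReal_mul hp.le, ← ENNReal.ofReal_mul ha',
    ← ENNReal.ofReal_mul hp1, ← ENNReal.ofReal_add (by positivity) (by positivity), jointMass]

/-- The uniform prior and the evidence, which is positive and finite, cancel from the comparison of
posteriors. -/
theorem isMAPEstimate_iff (g₁ g₂ : SimpleGraph (Fin n)) (π : Equiv.Perm (Fin n)) :
    θ.IsMAPEstimate g₁ g₂ π ↔
      ∀ π' : Equiv.Perm (Fin n), θ.likelihood g₁ g₂ π' ≤ θ.likelihood g₁ g₂ π := by
  classical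
  set N : ENNReal := ((Fintype.card (Equiv.Perm (Fin n)) : ENNReal))⁻¹ with hN
  have hN0 : N ≠ 0 := by simp [hN]
  have hNt : N ≠ ⊤ := by simp [hN]
  have hj : ∀ π', θ.jointLaw (π', (g₁, g₂)) = N * ENNReal.ofReal (θ.likelihood g₁ g₂ π') := by
    intro π'
    rw [jointLaw, PMF.bind_apply, tsum_fintype, Finset.sum_eq_single π']
    · rw [PMF.map_apply, tsum_fintype, Finset.sum_eq_single (g₁, g₂)]
      · rw [if_pos rfl, observedLaw_apply, PMF.uniformOfFintype_apply]
      · intro x _ hx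
        rw [if_neg]
        exact fun h => hx (Prod.ext_iff.1 h).2.symm
      · simp
    · intro σ _ hσ
      rw [PMF.map_apply, tsum_fintype, Finset.sum_eq_zero, mul_zero]
      intro x _
      rw [if_neg]
      exact fun h => hσ (Prod.ext_iff.1 h).1.symm
    · simp
  have hS0 : ∑ π', θ.jointLaw (π', (g₁, g₂)) ≠ 0 := by
    intro h
    have h1 := Finset.sum_eq_zero_iff.1 h π (Finset.mem_univ _)
    rw [hj] at h1
    exact (mul_ne_zero hN0 (by simpa using θ.likelihood_pos g₁ g₂ π)) h1
  have hSt : ∑ π', θ.jointLaw (π', (g₁, g₂)) ≠ ⊤ :=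
    ENNReal.sum_ne_top.2 fun π' _ => by
      rw [hj]
      exact ENNReal.mul_ne_top hNt ENNReal.ofReal_ne_top
  refine forall_congr' fun π' => ?_
  rw [posterior, posterior, ENNReal.div_le_iff hS0 hSt, ENNReal.div_mul_cancel hS0 hSt, hj, hj,
    ENNReal.mul_le_mul_iff_right hN0 hNt, ENNReal.ofReal_le_ofReal_iff (θ.likelihood_pos _ _ _).le]

/-! ### Maximum likelihood as minimal cost. -/

/-- The weight of a pair of nodes, as a function of the unordered pair. -/
noncomputable def edgeWeight (e : Sym2 (Fin n)) : ℝ :=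
  Real.log ((1 - θ.edgeProb e * (θ.s₁ + θ.s₂ - θ.s₁ * θ.s₂)) /
    (θ.edgeProb e * (1 - θ.s₁) * (1 - θ.s₂)))

theorem cost_eq (g₁ g₂ : SimpleGraph (Fin n)) (π : Equiv.Perm (Fin n)) :
    θ.cost g₁ g₂ π = ∑ e : NodePair n, θ.edgeWeight e *
      if !hasEdge g₁ e && hasEdge g₂ (edgePerm π e) then 1 else 0 := by
  have h := sum_pairs fun e : Sym2 (Fin n) => θ.edgeWeight e *
      if !hasEdge g₁ e && hasEdge g₂ (e.map π) then (1 : ℝ) else 0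
  rw [cost]
  refine Eq.trans ?_ h
  refine Finset.sum_congr rfl fun e _ => ?_
  have h1 : (¬ g₁.Adj e.1 e.2 ∧ g₂.Adj (π e.1) (π e.2)) ↔
      (!hasEdge g₁ s(e.1, e.2) && hasEdge g₂ (Sym2.map π s(e.1, e.2))) = true := by
    rw [Bool.and_eq_true, Sym2.map_mk, hasEdge_mk, Bool.not_eq_true', ← Bool.not_eq_true,
      hasEdge_mk]
  simp only [h1]
  rfl

/-- The weight is the log odds ratio of the table, charged to the cell "absent from `G₁`, present in
`G₂`". The factor of `b` is free of the affinity, hence unaffected by relabelling. -/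
theorem jointMass_eq_mul_exp (e : Sym2 (Fin n)) (a b : Bool) :
    jointMass (θ.edgeProb e) θ.s₁ θ.s₂ a b =
      (if a then θ.edgeProb e * θ.s₁ * (1 - θ.s₂)
        else 1 - θ.edgeProb e * (θ.s₁ + θ.s₂ - θ.s₁ * θ.s₂)) *
      (if b then θ.s₂ / (1 - θ.s₂) else 1) *
      Real.exp (-(θ.edgeWeight e * if !a && b then 1 else 0)) := by
  have hp := θ.edgeProb_pos e
  have h1 : 0 < 1 - θ.s₁ := by linarith [θ.s₁_lt_one]
  have h2 : 0 < 1 - θ.s₂ := by linarith [θ.s₂_lt_one]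
  have h0 : 0 < 1 - θ.edgeProb e * (θ.s₁ + θ.s₂ - θ.s₁ * θ.s₂) := by
    have := θ.jointMass_edgeProb_pos e false false
    simp only [jointMass, if_false, Bool.false_eq_true] at this
    linarith
  have hw : Real.exp (-θ.edgeWeight e) = (θ.edgeProb e * (1 - θ.s₁) * (1 - θ.s₂)) /
      (1 - θ.edgeProb e * (θ.s₁ + θ.s₂ - θ.s₁ * θ.s₂)) := by
    rw [edgeWeight, ← Real.log_inv, Real.exp_log (by positivity), inv_div]
  cases a <;> cases b <;> simp [jointMass, hw] <;> field_simp
  ring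

theorem exists_likelihood_eq (g₁ g₂ : SimpleGraph (Fin n)) :
    ∃ K : ℝ, ∀ π, θ.likelihood g₁ g₂ π = K * Real.exp (-θ.cost g₁ g₂ π) := by
  refine ⟨(∏ e : NodePair n, if hasEdge g₁ e then θ.edgeProb e * θ.s₁ * (1 - θ.s₂)
        else 1 - θ.edgeProb e * (θ.s₁ + θ.s₂ - θ.s₁ * θ.s₂)) *
      ∏ e : NodePair n, if hasEdge g₂ e then θ.s₂ / (1 - θ.s₂) else 1, fun π => ?_⟩
  rw [cost_eq, ← Finset.sum_neg_distrib, Real.exp_sum, likelihood,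
    ← Equiv.prod_comp (edgePerm π) fun e : NodePair n =>
      if hasEdge g₂ e then θ.s₂ / (1 - θ.s₂) else 1,
    ← Finset.prod_mul_distrib, ← Finset.prod_mul_distrib]
  exact Finset.prod_congr rfl fun e _ => θ.jointMass_eq_mul_exp e _ _

theorem isMAPEstimate_iff_isCostMinimizer (g₁ g₂ : SimpleGraph (Fin n))
    (π : Equiv.Perm (Fin n)) : θ.IsMAPEstimate g₁ g₂ π ↔ θ.IsCostMinimizer g₁ g₂ π := by
  obtain ⟨K, hK⟩ := θ.exists_likelihood_eq g₁ g₂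
  have hK0 : 0 < K := by
    have := θ.likelihood_pos g₁ g₂ π
    rw [hK] at this
    exact pos_of_mul_pos_left this (Real.exp_pos _).le
  rw [isMAPEstimate_iff]
  refine forall_congr' fun π' => ?_
  rw [hK, hK, mul_le_mul_iff_right₀ hK0, Real.exp_le_exp, neg_le_neg_iff]

end Params

end Deanon

/-! ### Overlap matrices and the Bhattacharyya bound. -/

namespace Deanon

/-- The overlap matrix of the laws of the pair of observations given the auxiliary one. -/
noncomputable def overlapMatrix (p s₁ s₂ : ℝ) : Matrix Bool Bool ℝ :=
  fun x y => ∑ a, √(jointMass p s₁ s₂ a x) * √(jointMass p s₁ s₂ a y)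

theorem overlapMatrix_nonneg (p s₁ s₂ : ℝ) (x y : Bool) : 0 ≤ overlapMatrix p s₁ s₂ x y :=
  Finset.sum_nonneg fun _ _ => mul_nonneg (Real.sqrt_nonneg _) (Real.sqrt_nonneg _)

section OverlapBounds

variable {p s₁ s₂ : ℝ} (hp : 0 < p) (hp1 : p ≤ 1) (h1 : 0 < s₁) (h1' : s₁ < 1)
    (h2 : 0 < s₂) (h2' : s₂ < 1)

include hp hp1 h1 h1' h2 h2' in
theorem trace_overlapMatrix : Matrix.trace (overlapMatrix p s₁ s₂) = 1 := by
  have h := fun a b => Real.mul_self_sqrt (jointMass_pos hp hp1 h1 h1' h2 h2' a b).le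
  simp only [Matrix.trace, Matrix.diag_apply, overlapMatrix, Fintype.sum_bool, h]
  simp only [jointMass, if_true, if_false, Bool.false_eq_true]
  ring

-- With `R` the matrix of square roots of the table, the overlap matrix is `RᵀR`, of trace 1, so its
-- squared norm is `1 - 2 (det R)²`. For small `p` the determinant is bounded below by a multiple of
-- `√(p s₁ s₂)`.
include hp h1 h1' h2 h2' in
theorem hsNorm_overlapMatrix_le (hp64 : p ≤ 1 / 64) :
    hsNorm (overlapMatrix p s₁ s₂) ≤ Real.exp (-(p * s₁ * s₂) / 2) := by
  have hp1 : p ≤ 1 := by linarith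
  set r : Bool → Bool → ℝ := fun a b => √(jointMass p s₁ s₂ a b) with hr
  have hJ : ∀ a b, r a b * r a b = jointMass p s₁ s₂ a b := fun a b =>
    Real.mul_self_sqrt (jointMass_pos hp hp1 h1 h1' h2 h2' a b).le
  have hr0 : ∀ a b, 0 ≤ r a b := fun a b => Real.sqrt_nonneg _
  have hsum : r true true * r true true + r false true * r false true +
      r true false * r true false + r false false * r false false = 1 := by
    simp only [hJ]
    simp only [jointMass, if_true, if_false, Bool.false_eq_true]
    ring
  have hsq : hsNorm (overlapMatrix p s₁ s₂) ^ 2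
      = 1 - 2 * (r false false * r true true - r true false * r false true) ^ 2 := by
    rw [hsNorm_sq]
    simp only [overlapMatrix, Fintype.sum_bool]
    change (r true true * r true true + r false true * r false true) ^ 2 +
      (r true true * r true false + r false true * r false false) ^ 2 +
      ((r true false * r true true + r false false * r false true) ^ 2 +
      (r true false * r true false + r false false * r false false) ^ 2) = _
    linear_combination (r true true * r true true + r false true * r false true +
      r true false * r true false + r false false * r false false + 1) * hsum
  have hm1 : 0 < 1 - s₁ := by linarith
  have hm2 : 0 < 1 - s₂ := by linarith
  have h11 : r true true = √(p * s₁ * s₂) := by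
    simp [hr, jointMass, mul_assoc]
  have h10 : r true false * r false true = √(p * s₁ * s₂) * √(p * (1 - s₁) * (1 - s₂)) := by
    rw [← Real.sqrt_mul (show 0 ≤ p * s₁ * s₂ by positivity)]
    change √(jointMass p s₁ s₂ true false) * √(jointMass p s₁ s₂ false true) = _
    rw [← Real.sqrt_mul (jointMass_pos hp hp1 h1 h1' h2 h2' _ _).le]
    congr 1
    simp only [jointMass, if_true, if_false, Bool.false_eq_true]
    ring
  have h00 : 7 / 8 ≤ r false false := by
    refine Real.le_sqrt_of_sq_le ?_
    simp only [jointMass, if_false, Bool.false_eq_true]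
    have : 0 < p * ((1 - s₁) * (1 - s₂)) := by positivity
    nlinarith
  have hsm : √(p * (1 - s₁) * (1 - s₂)) ≤ 1 / 8 := by
    refine Real.sqrt_le_iff.2 ⟨by norm_num, ?_⟩
    have : p * (1 - s₁) * (1 - s₂) ≤ p * 1 * 1 := by gcongr <;> linarith
    linarith
  -- The bracket left after factoring out `√(p s₁ s₂)` is at least `7/8 - 1/8 = 3/4`, and `(3/4)² ≥
  -- 1/2`.
  have hdet : p * s₁ * s₂ / 2 ≤
      (r false false * r true true - r true false * r false true) ^ 2 := by
    rw [h10, h11, show r false false * √(p * s₁ * s₂) -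
      √(p * s₁ * s₂) * √(p * (1 - s₁) * (1 - s₂)) =
      √(p * s₁ * s₂) * (r false false - √(p * (1 - s₁) * (1 - s₂))) by ring, mul_pow,
      Real.sq_sqrt (by positivity), div_eq_mul_inv]
    gcongr
    nlinarith
  refine abs_le_of_sq_le_sq' ?_ (Real.exp_pos _).le |>.2
  rw [hsq, ← Real.exp_nat_mul]
  have := Real.add_one_le_exp (((2 : ℕ) : ℝ) * (-(p * s₁ * s₂) / 2))
  push_cast at this ⊢
  linarith

end OverlapBounds

namespace Params

variable {n : ℕ} (θ : Params n)

/-- A bound for the Bhattacharyya coefficient of the laws of the observed networks under two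
mappings. -/
theorem sum_sqrt_likelihood_le (π₀ π : Equiv.Perm (Fin n)) :
    ∑ x : SimpleGraph (Fin n) × SimpleGraph (Fin n),
        √(θ.likelihood x.1 x.2 π₀ * θ.likelihood x.1 x.2 π) ≤
      ∏ e, traceFactor (edgePerm (π₀⁻¹ * π))
        (fun e : NodePair n => overlapMatrix (θ.edgeProb e) θ.s₁ θ.s₂) e := by
  classical
  refine le_trans (le_of_eq ?_) (sum_prod_perm_le _ _ fun e => overlapMatrix_nonneg _ _ _)
  rw [Fintype.sum_prod_type_right]
  -- Reading `g₂` through `π₀` turns the two arguments of each overlap matrix into the values at `e`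
  -- and at its image under `π₀⁻¹ * π`.
  refine Fintype.sum_equiv
    ((graphEquiv n).trans (Equiv.arrowCongr (edgePerm π₀).symm (Equiv.refl Bool))) _ _ fun g₂ => ?_
  have hg : ∀ e : NodePair n, ((graphEquiv n).trans
      (Equiv.arrowCongr (edgePerm π₀).symm (Equiv.refl Bool))) g₂ e
        = hasEdge g₂ (edgePerm π₀ e) := fun e => rfl
  have hg' : ∀ e : NodePair n, hasEdge g₂ (edgePerm π₀ (edgePerm (π₀⁻¹ * π) e))
      = hasEdge g₂ (edgePerm π e) := fun e => by
    rw [← edgePerm_symm_edgePerm, Equiv.apply_symm_apply]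
  simp only [hg, hg']
  have hG := sum_prod_hasEdge fun (e : NodePair n) a =>
    √(jointMass (θ.edgeProb e) θ.s₁ θ.s₂ a (hasEdge g₂ (edgePerm π₀ e))) *
      √(jointMass (θ.edgeProb e) θ.s₁ θ.s₂ a (hasEdge g₂ (edgePerm π e)))
  refine Eq.trans (Finset.sum_congr rfl fun g₁ _ => ?_) (hG.trans ?_)
  · have hsqrt : ∀ π', √(θ.likelihood g₁ g₂ π') = ∏ e : NodePair n,
        √(jointMass (θ.edgeProb e) θ.s₁ θ.s₂ (hasEdge g₁ e) (hasEdge g₂ (edgePerm π' e))) :=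
      fun π' => Real.sqrt_prod _ fun e _ => (θ.jointMass_edgeProb_pos e _ _).le
    rw [Real.sqrt_mul (θ.likelihood_pos _ _ _).le, hsqrt, hsqrt, Finset.prod_mul_distrib]
  · refine Finset.prod_congr rfl fun e _ => ?_
    rw [overlapMatrix, Fintype.sum_bool]

theorem sum_sqrt_likelihood_le_pow (π₀ π : Equiv.Perm (Fin n)) {a : ℝ} (ha0 : 0 ≤ a)
    (ha : ∀ e, a ≤ θ.edgeProb e) (hb : ∀ e, θ.edgeProb e ≤ 1 / 64) (hn : 2 ≤ n) :
    ∑ x : SimpleGraph (Fin n) × SimpleGraph (Fin n),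
        √(θ.likelihood x.1 x.2 π₀ * θ.likelihood x.1 x.2 π) ≤
      Real.exp (-(a * θ.s₁ * θ.s₂ * (n - 2) / 4)) ^ (π₀⁻¹ * π).support.card := by
  classical
  set σ := π₀⁻¹ * π
  have hs1 := θ.s₁_pos
  have hs2 := θ.s₂_pos
  calc _ ≤ _ := θ.sum_sqrt_likelihood_le π₀ π
    _ ≤ ∏ e, if edgePerm σ e = e then 1 else Real.exp (-(a * θ.s₁ * θ.s₂) / 2) := by
        refine Finset.prod_le_prod (fun e _ => traceFactor_nonneg _ _
          (fun e => overlapMatrix_nonneg _ _ _) e) fun e _ => ?_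
        unfold traceFactor
        split_ifs
        · exact (trace_overlapMatrix (θ.edgeProb_pos e) (θ.edgeProb_le_one e) θ.s₁_pos
            θ.s₁_lt_one θ.s₂_pos θ.s₂_lt_one).le
        · refine (hsNorm_overlapMatrix_le (θ.edgeProb_pos e) θ.s₁_pos θ.s₁_lt_one θ.s₂_pos
            θ.s₂_lt_one (hb e)).trans (Real.exp_le_exp.2 ?_)
          have : a * θ.s₁ * θ.s₂ ≤ θ.edgeProb e * θ.s₁ * θ.s₂ := by
            gcongr
            exact ha e
          linarith
    _ = Real.exp (-(a * θ.s₁ * θ.s₂) / 2) ^ (edgePerm σ).support.card := by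
        rw [Finset.prod_ite, Finset.prod_const_one, one_mul, Finset.prod_const]
        rfl
    _ ≤ _ := by
        rw [← Real.exp_nat_mul, ← Real.exp_nat_mul, Real.exp_le_exp]
        have h : ((σ.support.card * (n - 2) : ℕ) : ℝ) ≤ (2 * (edgePerm σ).support.card : ℕ) :=
          Nat.cast_le.2 (card_support_mul_le σ)
        push_cast [Nat.cast_sub hn] at h
        have hq : 0 ≤ a * θ.s₁ * θ.s₂ := by positivity
        nlinarith [mul_le_mul_of_nonneg_left h hq]

/-! ### Union bound over the wrong mappings. -/

theorem observedLaw_likelihood_le (π₀ π : Equiv.Perm (Fin n)) :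
    (θ.observedLaw π₀).toOuterMeasure
        {x | θ.likelihood x.1 x.2 π₀ ≤ θ.likelihood x.1 x.2 π} ≤
      ENNReal.ofReal (∑ x : SimpleGraph (Fin n) × SimpleGraph (Fin n),
        √(θ.likelihood x.1 x.2 π₀ * θ.likelihood x.1 x.2 π)) := by
  classical
  rw [PMF.toOuterMeasure_apply_fintype, ENNReal.ofReal_sum_of_nonneg fun _ _ => Real.sqrt_nonneg _]
  refine Finset.sum_le_sum fun x _ => Set.indicator_apply_le' (fun hx => ?_)
    fun _ => zero_le
  obtain ⟨g₁, g₂⟩ := x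
  rw [observedLaw_apply]
  -- On this event `L(π₀)² ≤ L(π₀) L(π)`.
  refine ENNReal.ofReal_le_ofReal (Real.le_sqrt_of_sq_le ?_)
  rw [sq]
  exact mul_le_mul_of_nonneg_left hx (θ.likelihood_pos _ _ _).le

/-- A union bound for the probability that the maximum a posteriori estimate is not unique or not
correct. -/
theorem one_le_observedLaw_add (π₀ : Equiv.Perm (Fin n)) {a : ℝ} (ha0 : 0 ≤ a)
    (ha : ∀ e, a ≤ θ.edgeProb e) (hb : ∀ e, θ.edgeProb e ≤ 1 / 64) (hn : 2 ≤ n) :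
    1 ≤ (θ.observedLaw π₀).toOuterMeasure
        {x | ∀ π : Equiv.Perm (Fin n), θ.IsMAPEstimate x.1 x.2 π ↔ π = π₀} +
      ENNReal.ofReal ((1 + n * Real.exp (-(a * θ.s₁ * θ.s₂ * (n - 2) / 4))) ^ n - 1) := by
  classical
  set x := Real.exp (-(a * θ.s₁ * θ.s₂ * (n - 2) / 4)) with hx
  set μ := (θ.observedLaw π₀).toOuterMeasure with hμ
  set good : Set (SimpleGraph (Fin n) × SimpleGraph (Fin n)) :=
    {x | ∀ π : Equiv.Perm (Fin n), θ.IsMAPEstimate x.1 x.2 π ↔ π = π₀} with hgood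
  set bad : Equiv.Perm (Fin n) → Set (SimpleGraph (Fin n) × SimpleGraph (Fin n)) := fun π =>
    {x | θ.likelihood x.1 x.2 π₀ ≤ θ.likelihood x.1 x.2 π} with hbad
  have hcover : Set.univ ⊆ good ∪ ⋃ π ∈ Finset.univ.erase π₀, bad π := by
    rintro ⟨g₁, g₂⟩ -
    by_cases h : ∃ π, π ≠ π₀ ∧ θ.likelihood g₁ g₂ π₀ ≤ θ.likelihood g₁ g₂ π
    · obtain ⟨π, hπ, hle⟩ := h
      right
      simp only [Set.mem_iUnion]
      exact ⟨π, Finset.mem_erase.2 ⟨hπ, Finset.mem_univ _⟩, hle⟩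
    · left
      push Not at h
      intro π
      rw [isMAPEstimate_iff]
      constructor
      · intro hmax
        by_contra hne
        exact absurd (hmax π₀) (not_le.2 (h π hne))
      · rintro rfl π'
        rcases eq_or_ne π' π with rfl | hne
        · exact le_rfl
        · exact (h π' hne).le
  have huniv : μ Set.univ = 1 := (PMF.toOuterMeasure_apply_eq_one_iff _ _).2 (Set.subset_univ _)
  rw [← huniv]
  refine (MeasureTheory.measure_mono hcover).trans
    ((MeasureTheory.measure_union_le _ _).trans (add_le_add le_rfl ?_))
  refine (MeasureTheory.measure_biUnion_finset_le _ _).trans ?_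
  calc ∑ π ∈ Finset.univ.erase π₀, μ (bad π)
      ≤ ∑ π ∈ Finset.univ.erase π₀, ENNReal.ofReal (x ^ (π₀⁻¹ * π).support.card) :=
        Finset.sum_le_sum fun π _ => (θ.observedLaw_likelihood_le π₀ π).trans
          (ENNReal.ofReal_le_ofReal (θ.sum_sqrt_likelihood_le_pow π₀ π ha0 ha hb hn))
    _ = ENNReal.ofReal (∑ π ∈ Finset.univ.erase π₀, x ^ (π₀⁻¹ * π).support.card) :=
        (ENNReal.ofReal_sum_of_nonneg fun _ _ => by positivity).symm
    _ ≤ _ := by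
        refine ENNReal.ofReal_le_ofReal ?_
        -- The omitted term `π = π₀` equals `x ^ 0 = 1`, which accounts for the `- 1`.
        have h1 := Finset.add_sum_erase Finset.univ
          (fun π : Equiv.Perm (Fin n) => x ^ (π₀⁻¹ * π).support.card) (Finset.mem_univ π₀)
        have h2 : ∑ π : Equiv.Perm (Fin n), x ^ (π₀⁻¹ * π).support.card
            = ∑ σ : Equiv.Perm (Fin n), x ^ σ.support.card :=
          Equiv.sum_comp (Equiv.mulLeft π₀⁻¹) fun σ : Equiv.Perm (Fin n) => x ^ σ.support.card
        have h3 := sum_perm_pow_support_le (ι := Fin n) (Real.exp_pos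
          (-(a * θ.s₁ * θ.s₂ * (n - 2) / 4))).le
        rw [Fintype.card_fin] at h3
        simp only [inv_mul_cancel, Equiv.Perm.support_one, Finset.card_empty, pow_zero] at h1
        linarith

/-! ### From the density hypothesis to recovery. -/

theorem α_le_edgeProb (e : Sym2 (Fin n)) : θ.α ≤ θ.edgeProb e := by
  induction e with
  | _ i j =>
    exact ciInf_le (f := fun ab : Fin θ.κ × Fin θ.κ => θ.p ab.1 ab.2)
      (Set.finite_range _).bddBelow (θ.c i, θ.c j)

theorem edgeProb_le_β (e : Sym2 (Fin n)) : θ.edgeProb e ≤ θ.β := by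
  induction e with
  | _ i j =>
    exact le_ciSup (f := fun ab : Fin θ.κ × Fin θ.κ => θ.p ab.1 ab.2)
      (Set.finite_range _).bddAbove (θ.c i, θ.c j)

theorem α_pos : 0 < θ.α := by
  have : Nonempty (Fin θ.κ) := ⟨⟨0, θ.κ_pos⟩⟩
  obtain ⟨ab, h⟩ := exists_eq_ciInf_of_finite (f := fun ab : Fin θ.κ × Fin θ.κ => θ.p ab.1 ab.2)
  rw [α, ← h]
  exact θ.p_pos _ _

theorem β_pos : 0 < θ.β :=
  (θ.p_pos ⟨0, θ.κ_pos⟩ ⟨0, θ.κ_pos⟩).trans_le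
    (le_ciSup (f := fun ab : Fin θ.κ × Fin θ.κ => θ.p ab.1 ab.2)
      (Set.finite_range _).bddAbove (⟨0, θ.κ_pos⟩, ⟨0, θ.κ_pos⟩))

/-- A large density forces the expected number of common neighbours of a node in the two networks
to be large compared with `log n`. -/
theorem log_le_of_le_density (hα : θ.α < 1) (hβ : θ.β ≤ 1) (hn : 3 ≤ n)
    (h : 24 * Real.log n ^ 2 / n ≤ θ.density) :
    24 * Real.log n ≤ θ.α * θ.s₁ * θ.s₂ * n := by
  have hα0 := θ.α_pos
  have hβ0 := θ.β_pos
  have hs1 := θ.s₁_pos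
  have hs2 := θ.s₂_pos
  have hs1' := θ.s₁_lt_one
  have hs2' := θ.s₂_lt_one
  have hn0 : (0 : ℝ) < n := by positivity
  have hn3 : (3 : ℝ) ≤ n := by exact_mod_cast hn
  have hlog : 0 < Real.log (1 / θ.α) := Real.log_pos (by rw [lt_div_iff₀ hα0]; linarith)
  have hlogn : 1 ≤ Real.log n := by
    rw [Real.le_log_iff_exp_le hn0]
    exact Real.exp_one_lt_three.le.trans hn3
  have hq : θ.s₁ * θ.s₂ ≤ (θ.s₁ + θ.s₂) / 2 := by nlinarith
  have hd : θ.density ≤ θ.α * θ.s₁ * θ.s₂ * Real.log (1 / θ.α) / 2 := by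
    rw [density, div_le_iff₀ (by positivity)]
    have hβ2 : (1 - θ.β) ^ 2 ≤ 1 := by nlinarith
    calc θ.α * (1 - θ.β) ^ 2 * θ.s₁ ^ 2 * θ.s₂ ^ 2 * Real.log (1 / θ.α)
        ≤ θ.α * 1 * θ.s₁ ^ 2 * θ.s₂ ^ 2 * Real.log (1 / θ.α) := by gcongr
      _ = θ.α * θ.s₁ * θ.s₂ * Real.log (1 / θ.α) * (θ.s₁ * θ.s₂) := by ring
      _ ≤ θ.α * θ.s₁ * θ.s₂ * Real.log (1 / θ.α) * ((θ.s₁ + θ.s₂) / 2) := by gcongr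
      _ = _ := by ring
  have h1 : 48 * Real.log n ^ 2 ≤ θ.α * θ.s₁ * θ.s₂ * n * Real.log (1 / θ.α) := by
    have := (div_le_iff₀ hn0).1 (h.trans hd)
    linarith
  -- A bootstrap: the crude bound `log (1/α) ≤ 2/√α` turns `h1` into `√α n ≥ 1`, that is `1/α ≤ n²`.
  -- Putting this back into `h1` cancels one factor `log n`.
  have h2 : Real.log (1 / θ.α) ≤ 2 * Real.log n := by
    have hsα : 0 < √θ.α := Real.sqrt_pos.2 hα0
    have hss : √θ.α * √θ.α = θ.α := Real.mul_self_sqrt hα0.le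
    have h3 : Real.log (1 / θ.α) ≤ 2 * (1 / √θ.α) := by
      have h4 : 1 / θ.α = (1 / √θ.α) ^ 2 := by rw [div_pow, one_pow, sq, hss]
      rw [h4, Real.log_pow]
      have := Real.log_le_self (show 0 ≤ 1 / √θ.α by positivity)
      push_cast
      linarith
    have h5 : 1 ≤ √θ.α * n := by
      have h6 : θ.α * θ.s₁ * θ.s₂ * n * Real.log (1 / θ.α) ≤
          θ.α * 1 * 1 * n * (2 * (1 / √θ.α)) := by gcongr
      have h7 : θ.α * 1 * 1 * n * (2 * (1 / √θ.α)) = 2 * (√θ.α * n) := by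
        have : θ.α * (1 / √θ.α) = √θ.α := by rw [mul_one_div, Real.div_sqrt]
        linear_combination 2 * n * this
      nlinarith
    have h8 : 1 / θ.α ≤ (n : ℝ) ^ 2 := by
      have : (n : ℝ) ^ 2 * θ.α = (√θ.α * n) ^ 2 := by rw [mul_pow, Real.sq_sqrt hα0.le, mul_comm]
      rw [div_le_iff₀ hα0, this]
      exact one_le_pow₀ h5
    calc Real.log (1 / θ.α) ≤ Real.log ((n : ℝ) ^ 2) := Real.log_le_log (by positivity) h8
      _ = 2 * Real.log n := by rw [Real.log_pow]; norm_num
  have h9 : 0 ≤ θ.α * θ.s₁ * θ.s₂ * n := by positivity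
  nlinarith [mul_le_mul_of_nonneg_left h2 h9]

/-- A quantitative form of the recovery of the correct mapping. -/
theorem one_sub_le_observedLaw (π₀ : Equiv.Perm (Fin n)) (hα : θ.α < 1) (hβ : θ.β ≤ 1 / 64)
    (hn : 4 ≤ n) (h : 24 * Real.log n ^ 2 / n ≤ θ.density) :
    1 - ENNReal.ofReal (Real.exp (1 / n) - 1) ≤ (θ.observedLaw π₀).toOuterMeasure
        {x | ∀ π : Equiv.Perm (Fin n), θ.IsMAPEstimate x.1 x.2 π ↔ π = π₀} := by
  rw [tsub_le_iff_right]
  refine (θ.one_le_observedLaw_add π₀ θ.α_pos.le θ.α_le_edgeProb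
    (fun e => (θ.edgeProb_le_β e).trans hβ) (by omega)).trans (add_le_add le_rfl ?_)
  refine ENNReal.ofReal_le_ofReal (sub_le_sub_right ?_ 1)
  have hn0 : (0 : ℝ) < n := by positivity
  have hn4 : (4 : ℝ) ≤ n := by exact_mod_cast hn
  have h1 := θ.log_le_of_le_density hα (by linarith) (by omega) h
  -- As `n ≥ 4` gives `n - 2 ≥ n / 2`, the exponent is at least `24 log n / 8 = 3 log n`; this is
  -- where the constant 24 comes from.
  have hx : Real.exp (-(θ.α * θ.s₁ * θ.s₂ * (n - 2) / 4)) ≤ ((n : ℝ) ^ 3)⁻¹ := by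
    rw [← Real.exp_log (show (0 : ℝ) < ((n : ℝ) ^ 3)⁻¹ by positivity), Real.exp_le_exp,
      Real.log_inv, Real.log_pow]
    have hq : 0 < θ.α * θ.s₁ * θ.s₂ := mul_pos (mul_pos θ.α_pos θ.s₁_pos) θ.s₂_pos
    push_cast
    nlinarith
  calc (1 + n * Real.exp (-(θ.α * θ.s₁ * θ.s₂ * (n - 2) / 4))) ^ n
      ≤ (1 + n * ((n : ℝ) ^ 3)⁻¹) ^ n := by gcongr
    _ ≤ Real.exp (n * ((n : ℝ) ^ 3)⁻¹) ^ n := by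
        gcongr
        linarith [Real.add_one_le_exp (n * ((n : ℝ) ^ 3)⁻¹)]
    _ = Real.exp (1 / n) := by
        rw [← Real.exp_nat_mul]
        congr 1
        field_simp

end Params

end Deanon

theorem theorem6p1 :
    -- The minimizers of the single-sided cost are exactly the MAP estimates.
    (∀ (n : ℕ) (θ : Deanon.Params n) (g₁ g₂ : SimpleGraph (Fin n)) (π : Equiv.Perm (Fin n)),
      θ.IsMAPEstimate g₁ g₂ π ↔ θ.IsCostMinimizer g₁ g₂ π) ∧
    -- Asymptotically almost surely the MAP estimate is unique and equal to the correct mapping.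
    ∃ C : ℝ, 0 < C ∧
      ∀ (θ : ∀ n : ℕ, Deanon.Params n) (γ : ℕ → ℝ),
        Tendsto (fun n => (θ n).α) atTop (𝓝 0) →
        Tendsto (fun n => (θ n).β) atTop (𝓝 0) →
        ¬ Tendsto (fun n => (θ n).s₁) atTop (𝓝 1) →
        ¬ Tendsto (fun n => (θ n).s₂) atTop (𝓝 1) →
        (∀ᶠ n in atTop, Real.log (θ n).α / Real.log (θ n).β ≤ γ n) →
        -- `density = Ω(γ log² n / n) + ω(1 / n)`
        (fun n : ℕ => γ n * Real.log n ^ 2 / n) =O[atTop] (fun n => (θ n).density) →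
        (fun n : ℕ => 1 / (n : ℝ)) =o[atTop] (fun n => (θ n).density) →
        -- the constant hidden in `Ω` is not too small for bounded `γ`
        (∀ᶠ n : ℕ in atTop, C * Real.log n ^ 2 / n ≤ (θ n).density) →
        ∀ π₀ : ∀ n : ℕ, Equiv.Perm (Fin n),
          Tendsto
            (fun n => ((θ n).observedLaw (π₀ n)).toOuterMeasure
              {x | ∀ π : Equiv.Perm (Fin n), (θ n).IsMAPEstimate x.1 x.2 π ↔ π = π₀ n})
            atTop (𝓝 1) := by
  refine ⟨fun n θ g₁ g₂ π => θ.isMAPEstimate_iff_isCostMinimizer g₁ g₂ π, 24, by norm_num, ?_⟩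
  intro θ γ hα hβ _ _ _ _ _ hD π₀
  have hlim : Tendsto (fun n : ℕ => 1 - ENNReal.ofReal (Real.exp (1 / (n : ℝ)) - 1)) atTop
      (𝓝 1) := by
    have h1 : Tendsto (fun n : ℕ => Real.exp (1 / (n : ℝ)) - 1) atTop (𝓝 0) := by
      have := (Real.continuous_exp.tendsto 0).comp (tendsto_one_div_atTop_nhds_zero_nat (𝕜 := ℝ))
      simpa using this.sub_const 1
    have h2 := ENNReal.Tendsto.sub (tendsto_const_nhds (x := (1 : ENNReal)))
      (ENNReal.tendsto_ofReal h1) (Or.inl ENNReal.one_ne_top)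
    simpa using h2
  refine tendsto_of_tendsto_of_tendsto_of_le_of_le' hlim tendsto_const_nhds ?_ ?_
  · filter_upwards [hα.eventually_lt_const zero_lt_one,
      hβ.eventually_le_const (show (0 : ℝ) < 1 / 64 by norm_num), hD, eventually_ge_atTop 4]
      with n h1 h2 h3 h4
    exact (θ n).one_sub_le_observedLaw (π₀ n) h1 h2 h4 h3
  · refine Eventually.of_forall fun n => ?_
    rw [← (PMF.toOuterMeasure_apply_eq_one_iff ((θ n).observedLaw (π₀ n)) Set.univ).2
      (Set.subset_univ _)]
    exact MeasureTheory.measure_mono (Set.subset_univ _)
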